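/- Let $(X,S,Y)$ be random variables on a probability space with values in $\mathcal X\times\{1,2\}\times\mathbb R$, where $\mathcal X$ is any measurable space, $\mathbb P(S=1)>0$, $\mathbb P(S=2)>0$ and $Y\in\{0,1\}$ almost surely. Let $\mu$ be the law of $X$, let $\mu_s$ be the law of $X$ conditionally on $S=s$, and assume $\mu_1\neq\mu_2$. Let $m>0$ be the common mass of the positive and negative parts of the Jordan decomposition of $\mu_1-\mu_2$, put $\mu_\pm=(\mu_1-\mu_2)_\pm/m$, $\Delta=\frac{\mathrm d\mu_+}{\mathrm d\mu}-\frac{\mathrm d\mu_-}{\mathrm d\mu}$ and $\eta(x)=\mathbb E[Y\mid X=x]$. Assume: 1. (Regularity) for every measurable $F:\mathbb R\setminus\{0\}\to\mathbb R$, the laws of $(\eta(X),\Delta(X))$ under $X\sim\mu_+$ and under $X\sim\mu_-$ both give mass zero to the graph $\{(F(d),d): d\neq 0\}$; 2. (Nestedness) for every $y\in\mathbb R$ one can choose $\kappa(y)\in\mathbb R$ with $\mu_+(\eta(X)\ge y+\kappa(y)\Delta(X))=\mu_-(\eta(X)\ge y+\kappa(y)\Delta(X))$ in such a way that, for $\mu$-almost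 every $x$, the map $y\in\mathbb R\mapsto \mathbf 1\{\eta(x)\ge y+\kappa(y)\Delta(x)\}$ is nonincreasing. Then the fair regression problem of minimizing $\mathbb E[(Y-f(X))^2]$ over all measurable $f:\mathcal X\to\mathbb R$ such that $f(X)$ is independent of $S$ has a solution $f^*$, which is unique up to $\mu$-almost everywhere equality. Moreover, for every solution $f^*$ and every $y\in\mathbb R$ (in particular for every $y\in[0,1]$), the classifier $g_y(x)=\mathbf 1\{f^*(x)\ge y\}$ satisfies that $g_y(X)$ is independent of $S$, and it minimizes the cost-sensitive risk $$\mathcal R_y(g)=y\,\mathbb P(Y=0,\ g(X)=1)+(1-y)\,\mathbb P(Y=1,\ g(X)=0)$$ over all measurable $g:\mathcal X\to\{0,1\}$ such that $g(X)$ is independent of $S$. -/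

import Mathlib

open MeasureTheory ProbabilityTheory

noncomputable section

namespace FairLearning

variable {Ω 𝒳 : Type*} [MeasurableSpace Ω] [MeasurableSpace 𝒳]

/-! The data are a probability measure `P` on `Ω` and random variables `X : Ω → 𝒳` (features),
`S : Ω → Fin 2` (the sensitive attribute; the two labels `0`, `1` of `Fin 2` stand for the two
groups `1`, `2`) and `Y : Ω → ℝ` (the response). -/

/-- The marginal distribution `μ` of `X`. -/
def featureLaw (P : Measure Ω) (X : Ω → 𝒳) : Measure 𝒳 := P.map X

/-- The conditional law `μ_s` of `X` given `S = s`. -/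
def groupLaw (P : Measure Ω) (X : Ω → 𝒳) (S : Ω → Fin 2) (s : Fin 2) : Measure 𝒳 :=
  (cond P (S ⁻¹' {s})).map X

/-- The Bayes regression function `η(x) = 𝔼[Y | X = x]`, the mean of the regular conditional
distribution of `Y` given `X = x`. -/
def bayesRegression (P : Measure Ω) [IsFiniteMeasure P] (X : Ω → 𝒳) (Y : Ω → ℝ) (x : 𝒳) : ℝ :=
  ∫ t, t ∂(condDistrib Y X P x)

/-! ### Scaled Jordan decomposition of the difference of the two group laws -/

/-- The Jordan decomposition of a difference `ν₁ - ν₂` of finite measures. -/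
def jordan (ν₁ ν₂ : Measure 𝒳) [IsFiniteMeasure ν₁] [IsFiniteMeasure ν₂] :
    JordanDecomposition 𝒳 :=
  (ν₁.toSignedMeasure - ν₂.toSignedMeasure).toJordanDecomposition

instance (P : Measure Ω) (X : Ω → 𝒳) (S : Ω → Fin 2) (s : Fin 2) :
    IsFiniteMeasure (groupLaw P X S s) := by
  unfold groupLaw; infer_instance

/-- The mass `m` of the positive part of `μ_1 - μ_2`; it is also the mass of the negative part. -/
def jordanMass (P : Measure Ω) (X : Ω → 𝒳) (S : Ω → Fin 2) : ENNReal :=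
  (jordan (groupLaw P X S 0) (groupLaw P X S 1)).posPart Set.univ

/-- The probability measure `μ_+ = (μ_1 - μ_2)_+ / m`. -/
def muPlus (P : Measure Ω) (X : Ω → 𝒳) (S : Ω → Fin 2) : Measure 𝒳 :=
  (jordanMass P X S)⁻¹ • (jordan (groupLaw P X S 0) (groupLaw P X S 1)).posPart

/-- The probability measure `μ_- = (μ_1 - μ_2)_- / m`. -/
def muMinus (P : Measure Ω) (X : Ω → 𝒳) (S : Ω → Fin 2) : Measure 𝒳 :=
  (jordanMass P X S)⁻¹ • (jordan (groupLaw P X S 0) (groupLaw P X S 1)).negPart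

/-- The function `Δ`, the density of `μ_+` minus the density of `μ_-`, both with respect to `μ`.
As `μ_+` and `μ_-` are mutually singular, it equals (up to a `μ`-null set) the density of `μ_+`
where that is positive, minus the density of `μ_-` where that is positive, and `0` elsewhere. -/
def Delta (P : Measure Ω) (X : Ω → 𝒳) (S : Ω → Fin 2) (x : 𝒳) : ℝ :=
  ((muPlus P X S).rnDeriv (featureLaw P X) x).toReal -
    ((muMinus P X S).rnDeriv (featureLaw P X) x).toReal

/-! ### The regularity assumption -/

/-- A measure on the plane (coordinates `(h, d)`) gives zero mass to the graphs
`{(F(d), d) : d ≠ 0}` of all measurable functions `F : ℝ ∖ {0} → ℝ`. -/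
def NullOnGraphs (ρ : Measure (ℝ × ℝ)) : Prop :=
  ∀ F : {d : ℝ // d ≠ 0} → ℝ, Measurable F → ρ (Set.range fun d => (F d, (d : ℝ))) = 0

/-- The distributions of `(η(X), Δ(X))` under `X ∼ μ_+` and under `X ∼ μ_-` give zero mass to
graphs of functions. -/
def GraphAssumption (P : Measure Ω) [IsFiniteMeasure P] (X : Ω → 𝒳) (S : Ω → Fin 2)
    (Y : Ω → ℝ) : Prop :=
  NullOnGraphs ((muPlus P X S).map fun x => (bayesRegression P X Y x, Delta P X S x)) ∧
    NullOnGraphs ((muMinus P X S).map fun x => (bayesRegression P X Y x, Delta P X S x))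

/-! ### Nestedness -/

/-- The set `{x : η(x) ≥ y + κ Δ(x)}`. -/
def acceptSet (P : Measure Ω) [IsFiniteMeasure P] (X : Ω → 𝒳) (S : Ω → Fin 2) (Y : Ω → ℝ)
    (y κ : ℝ) : Set 𝒳 :=
  {x | y + κ * Delta P X S x ≤ bayesRegression P X Y x}

/-- The classifier `g_y^κ(x) = 𝟏{η(x) ≥ y + κ Δ(x)}`. -/
def shiftedClassifier (P : Measure Ω) [IsFiniteMeasure P] (X : Ω → 𝒳) (S : Ω → Fin 2)
    (Y : Ω → ℝ) (y κ : ℝ) : 𝒳 → ℝ :=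
  (acceptSet P X S Y y κ).indicator 1

/-- The set `I(y)` of the `κ` with
`μ_+(η(X) ≥ y + κ Δ(X)) = μ_-(η(X) ≥ y + κ Δ(X))`. -/
def fairShifts (P : Measure Ω) [IsFiniteMeasure P] (X : Ω → 𝒳) (S : Ω → Fin 2) (Y : Ω → ℝ)
    (y : ℝ) : Set ℝ :=
  {κ | muPlus P X S (acceptSet P X S Y y κ) = muMinus P X S (acceptSet P X S Y y κ)}

/-- The problem is nested: for some choice of `κ(y) ∈ I(y)`, `y ∈ ℝ`, for `μ`-almost all `x` the
map `y ↦ g_y^{κ(y)}(x)` is nonincreasing on `ℝ`. -/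
def Nested (P : Measure Ω) [IsFiniteMeasure P] (X : Ω → 𝒳) (S : Ω → Fin 2) (Y : Ω → ℝ) : Prop :=
  ∃ κ : ℝ → ℝ, (∀ y, κ y ∈ fairShifts P X S Y y) ∧
    ∀ᵐ x ∂(featureLaw P X), Antitone fun y => shiftedClassifier P X S Y y (κ y) x

/-! ### The two optimization problems -/

/-- Demographic parity: `f(X)` is independent of `S`. -/
def DemographicParity (P : Measure Ω) (X : Ω → 𝒳) (S : Ω → Fin 2) (f : 𝒳 → ℝ) : Prop :=
  IndepFun (fun ω => f (X ω)) S P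

/-- The quadratic risk `𝔼[(Y - f(X))²]`, with value in `[0, ∞]`. -/
def quadraticRisk (P : Measure Ω) (X : Ω → 𝒳) (Y : Ω → ℝ) (f : 𝒳 → ℝ) : ENNReal :=
  ∫⁻ ω, ENNReal.ofReal ((Y ω - f (X ω)) ^ 2) ∂P

/-- `f` minimizes the quadratic risk among all regression functions satisfying demographic
parity. -/
def IsOptimalFairRegression (P : Measure Ω) (X : Ω → 𝒳) (S : Ω → Fin 2) (Y : Ω → ℝ)
    (f : 𝒳 → ℝ) : Prop :=
  (Measurable f ∧ DemographicParity P X S f) ∧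
    ∀ h : 𝒳 → ℝ, Measurable h → DemographicParity P X S h →
      quadraticRisk P X Y f ≤ quadraticRisk P X Y h

/-- A classification function: a measurable function with values in `{0, 1}`. -/
def IsClassifier (g : 𝒳 → ℝ) : Prop :=
  Measurable g ∧ ∀ x, g x = 0 ∨ g x = 1

/-- The cost-sensitive risk
`R_y(g) = y ℙ(Y = 0, g(X) = 1) + (1 - y) ℙ(Y = 1, g(X) = 0)`. -/
def costRisk (P : Measure Ω) (X : Ω → 𝒳) (Y : Ω → ℝ) (y : ℝ) (g : 𝒳 → ℝ) : ℝ :=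
  y * P.real {ω | Y ω = 0 ∧ g (X ω) = 1} + (1 - y) * P.real {ω | Y ω = 1 ∧ g (X ω) = 0}

/-- `g` minimizes `R_y` among all classification functions satisfying demographic parity. -/
def IsOptimalFairClassifier (P : Measure Ω) (X : Ω → 𝒳) (S : Ω → Fin 2) (Y : Ω → ℝ) (y : ℝ)
    (g : 𝒳 → ℝ) : Prop :=
  (IsClassifier g ∧ DemographicParity P X S g) ∧
    ∀ h : 𝒳 → ℝ, IsClassifier h → DemographicParity P X S h →
      costRisk P X Y y g ≤ costRisk P X Y y h

/-- The thresholded function `x ↦ 𝟏{f(x) ≥ y}`. -/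
def threshold (f : 𝒳 → ℝ) (y : ℝ) : 𝒳 → ℝ := {x | y ≤ f x}.indicator 1

end FairLearning

end

noncomputable section

namespace FairLearning

open Set Filter Topology

set_option linter.unusedSectionVars false

/-! ### Balanced sets and the function assembled from nested acceptance regions -/

section NestedFamily

variable {𝒳 : Type*} [MeasurableSpace 𝒳]

/-! Demographic parity is linear in the upper level sets: it says `∫ Δ dμ = 0` over each `{f ≥ y}`
(`demographicParity_iff_levelFair`). For `f` with values in `[0, 1]`, the quadratic risk is `𝔼 Y`
plus twice the integral over `y ∈ (0, 1]` of `∫_{f ≥ y} (y - η) dμ` (`integral_response_sub_sq`,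
`integral_sq_sub_eq_layer`). Regression thus splits into one problem per level: minimize `∫_B (y -
η) dμ` over balanced sets `B`, which is the cost-sensitive problem up to a constant (`costRisk_eq`).

Each of these is solved by a Lagrange multiplier: `κ(y) Δ` integrates to zero over balanced sets,
and the acceptance region is where `y - η + κ(y) Δ ≤ 0`. Nestedness turns these regions into level
sets of one function, `nestedSup`, up to left limits in `y`; balance and optimality survive the
limit at every `y` (`levelFair_nestedSup`, `setIntegral_nestedSup_le`).

For uniqueness, a competitor of equal risk has optimal level sets for almost every `y`. The
minimizing set is a.e. unique unless `y - η + κ(y) Δ` vanishes with positive mass. Regularity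
excludes this where `Δ ≠ 0`; where `Δ = 0` it can happen for only countably many `y`
(`ae_eq_nestedSup`). Truncation to `[0, 1]` handles unbounded competitors. -/

/-- The acceptance region `{x | η x ≥ y + κ(y) Δ(x)}` at level `y`. -/
def accept (η Δ : 𝒳 → ℝ) (κ : ℝ → ℝ) (y : ℝ) : Set 𝒳 := {x | y + κ y * Δ x ≤ η x}

/-- The data of a nested family of fair acceptance regions. -/
structure IsNestedFamily (μ : Measure 𝒳) (η Δ : 𝒳 → ℝ) (κ : ℝ → ℝ) : Prop where
  measurable_eta : Measurable η
  measurable_delta : Measurable Δ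
  eta_mem : ∀ᵐ x ∂μ, η x ∈ Icc (0 : ℝ) 1
  integrable_delta : Integrable Δ μ
  integral_delta : ∫ x, Δ x ∂μ = 0
  fair : ∀ y, ∫ x in accept η Δ κ y, Δ x ∂μ = 0
  nested : ∀ᵐ x ∂μ, ∀ y z, y ≤ z → x ∈ accept η Δ κ z → x ∈ accept η Δ κ y
  null_graph : ∀ y c, μ {x | η x = y + c * Δ x ∧ Δ x ≠ 0} = 0

/-- All upper level sets of `f` are balanced with respect to `Δ`. -/
def LevelFair (μ : Measure 𝒳) (Δ f : 𝒳 → ℝ) : Prop :=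
  ∀ y : ℝ, ∫ x in {x | y ≤ f x}, Δ x ∂μ = 0

/-- The largest level in `[0, 1]` at which a point is still accepted. -/
def nestedSup (η Δ : 𝒳 → ℝ) (κ : ℝ → ℝ) (x : 𝒳) : ℝ :=
  ⨆ q : ℚ, {x | (0 : ℝ) < q ∧ (q : ℝ) < 1 ∧ x ∈ accept η Δ κ q}.indicator (fun _ => (q : ℝ)) x

variable {μ : Measure 𝒳} {η Δ : 𝒳 → ℝ} {κ : ℝ → ℝ}

lemma nestedSup_term_mem (q : ℚ) (x : 𝒳) :
    {x | (0 : ℝ) < q ∧ (q : ℝ) < 1 ∧ x ∈ accept η Δ κ q}.indicator (fun _ => (q : ℝ)) x ∈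
      Icc (0 : ℝ) 1 := by
  by_cases hx : x ∈ {x | (0 : ℝ) < q ∧ (q : ℝ) < 1 ∧ x ∈ accept η Δ κ q}
  · rw [indicator_of_mem hx]
    exact ⟨hx.1.le, hx.2.1.le⟩
  · rw [indicator_of_notMem hx]
    simp

lemma bddAbove_nestedSup (x : 𝒳) : BddAbove (range fun q : ℚ =>
    {x | (0 : ℝ) < q ∧ (q : ℝ) < 1 ∧ x ∈ accept η Δ κ q}.indicator (fun _ => (q : ℝ)) x) := by
  refine ⟨1, ?_⟩
  rintro _ ⟨q, rfl⟩
  exact (nestedSup_term_mem q x).2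

lemma nestedSup_mem (x : 𝒳) : nestedSup η Δ κ x ∈ Icc (0 : ℝ) 1 :=
  ⟨(nestedSup_term_mem 0 x).1.trans (le_ciSup (bddAbove_nestedSup x) 0),
    ciSup_le fun q => (nestedSup_term_mem q x).2⟩

lemma le_nestedSup {q : ℚ} {x : 𝒳} (h0 : (0 : ℝ) < q) (h1 : (q : ℝ) < 1)
    (hx : x ∈ accept η Δ κ q) : (q : ℝ) ≤ nestedSup η Δ κ x := by
  refine le_trans (le_of_eq ?_) (le_ciSup (bddAbove_nestedSup x) q)
  rw [indicator_of_mem]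
  exact ⟨h0, h1, hx⟩

lemma exists_mem_accept_of_lt_nestedSup {r : ℝ} {x : 𝒳} (h0 : 0 < r)
    (hx : r < nestedSup η Δ κ x) : ∃ q : ℚ, r < q ∧ x ∈ accept η Δ κ q := by
  obtain ⟨q, hq⟩ := exists_lt_of_lt_ciSup hx
  by_cases hm : x ∈ {x | (0 : ℝ) < q ∧ (q : ℝ) < 1 ∧ x ∈ accept η Δ κ q}
  · rw [indicator_of_mem hm] at hq
    exact ⟨q, hq, hm.2.2⟩
  -- A rejected level contributes the default value `0`, which cannot exceed `r > 0`.
  · rw [indicator_of_notMem hm] at hq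
    linarith

/-- The supremum need not be attained, so only levels strictly below `y` are tested: the level set
is the intersection of the earlier acceptance regions, not the region at `y` itself. -/
lemma le_nestedSup_iff {x : 𝒳}
    (hx : ∀ y z, y ≤ z → x ∈ accept η Δ κ z → x ∈ accept η Δ κ y) {y : ℝ} (hy : y ∈ Ioc (0 : ℝ) 1) :
    y ≤ nestedSup η Δ κ x ↔ ∀ r ∈ Ioo 0 y, x ∈ accept η Δ κ r := by
  constructor
  · intro h r hr
    obtain ⟨q, hq, hm⟩ := exists_mem_accept_of_lt_nestedSup hr.1 (hr.2.trans_le h)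
    exact hx _ _ hq.le hm
  · intro h
    refine le_of_forall_lt fun r hr => ?_
    obtain ⟨q, hq, hqy⟩ := exists_rat_btwn (max_lt hr hy.1)
    have hq0 : (0 : ℝ) < q := (le_max_right _ _).trans_lt hq
    exact ((le_max_left _ _).trans_lt hq).trans_le
      (le_nestedSup hq0 (hqy.trans_le hy.2) (h q ⟨hq0, hqy⟩))

namespace IsNestedFamily

lemma measurableSet_accept (h : IsNestedFamily μ η Δ κ) (y : ℝ) :
    MeasurableSet (accept η Δ κ y) :=
  measurableSet_le (measurable_const.add (h.measurable_delta.const_mul _)) h.measurable_eta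

lemma measurable_nestedSup (h : IsNestedFamily μ η Δ κ) : Measurable (nestedSup η Δ κ) := by
  refine Measurable.iSup fun q => measurable_const.indicator ?_
  exact (MeasurableSet.const _).inter ((MeasurableSet.const _).inter (h.measurableSet_accept q))

lemma integrable_eta [IsFiniteMeasure μ] (h : IsNestedFamily μ η Δ κ) : Integrable η μ := by
  refine Integrable.of_bound h.measurable_eta.aestronglyMeasurable 1 ?_
  filter_upwards [h.eta_mem] with x hx
  rw [Real.norm_eq_abs, abs_of_nonneg hx.1]
  exact hx.2

/-- Up to a null set the regions decrease to the level set as the levels increase to `y`, so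
dominated convergence applies. This transfers both balance and optimality to `nestedSup`. -/
lemma tendsto_setIntegral_accept (h : IsNestedFamily μ η Δ κ) {y : ℝ} (hy : y ∈ Ioc (0 : ℝ) 1)
    {u : ℕ → ℝ} (hu : ∀ n, u n ∈ Ioo 0 y) (hlim : Tendsto u atTop (𝓝 y)) {φ : 𝒳 → ℝ}
    (hφ : Integrable φ μ) :
    Tendsto (fun n => ∫ x in accept η Δ κ (u n), φ x ∂μ) atTop
      (𝓝 (∫ x in {x | y ≤ nestedSup η Δ κ x}, φ x ∂μ)) := by
  have hL : MeasurableSet {x | y ≤ nestedSup η Δ κ x} :=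
    measurableSet_le measurable_const h.measurable_nestedSup
  simp_rw [← integral_indicator hL, ← integral_indicator (h.measurableSet_accept _)]
  refine tendsto_integral_of_dominated_convergence (fun x => ‖φ x‖)
    (fun n => hφ.aestronglyMeasurable.indicator (h.measurableSet_accept _)) hφ.norm
    (fun n => Eventually.of_forall fun x => norm_indicator_le_norm_self _ _) ?_
  filter_upwards [h.nested] with x hx
  refine tendsto_const_nhds.congr' ?_
  by_cases hm : y ≤ nestedSup η Δ κ x
  · refine Eventually.of_forall fun n => ?_
    dsimp only
    rw [indicator_of_mem (show x ∈ {x | y ≤ nestedSup η Δ κ x} from hm),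
      indicator_of_mem ((le_nestedSup_iff hx hy).1 hm _ (hu n))]
  · have hm' := hm
    rw [le_nestedSup_iff hx hy] at hm'
    push Not at hm'
    obtain ⟨r, hr, hxr⟩ := hm'
    filter_upwards [hlim.eventually (lt_mem_nhds hr.2)] with n hn
    rw [indicator_of_notMem (show x ∉ {x | y ≤ nestedSup η Δ κ x} from hm),
      indicator_of_notMem fun hmem => hxr (hx _ _ hn.le hmem)]

lemma levelFair_nestedSup (h : IsNestedFamily μ η Δ κ) :
    LevelFair μ Δ (nestedSup η Δ κ) := by
  intro y
  rcases le_or_gt y 0 with hy0 | hy0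
  · have : {x | y ≤ nestedSup η Δ κ x} = univ :=
      eq_univ_of_forall fun x => hy0.trans (nestedSup_mem x).1
    rw [this, setIntegral_univ, h.integral_delta]
  rcases le_or_gt y 1 with hy1 | hy1
  · obtain ⟨u, -, hu, hlim⟩ := exists_seq_strictMono_tendsto' hy0
    refine tendsto_nhds_unique
      (h.tendsto_setIntegral_accept ⟨hy0, hy1⟩ hu hlim h.integrable_delta) ?_
    simp [h.fair]
  · have : {x | y ≤ nestedSup η Δ κ x} = ∅ :=
      eq_empty_of_forall_notMem fun x hx => absurd (nestedSup_mem (η := η) (Δ := Δ) (κ := κ) x).2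
        (not_le.2 (hy1.trans_le hx))
    rw [this, setIntegral_empty]

variable [IsFiniteMeasure μ]

lemma integrable_sub_eta (h : IsNestedFamily μ η Δ κ) (y : ℝ) :
    Integrable (fun x => y - η x) μ := (integrable_const y).sub h.integrable_eta

lemma integrable_score (h : IsNestedFamily μ η Δ κ) (y c : ℝ) :
    Integrable (fun x => (y - η x) + c * Δ x) μ :=
  (h.integrable_sub_eta y).add (h.integrable_delta.const_mul c)

lemma setIntegral_score (h : IsNestedFamily μ η Δ κ) (y c : ℝ) {B : Set 𝒳}
    (hB : ∫ x in B, Δ x ∂μ = 0) :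
    ∫ x in B, ((y - η x) + c * Δ x) ∂μ = ∫ x in B, (y - η x) ∂μ := by
  rw [integral_add (h.integrable_sub_eta y).integrableOn
    (h.integrable_delta.const_mul c).integrableOn, integral_const_mul, hB, mul_zero, add_zero]

lemma accept_eq (y : ℝ) : accept η Δ κ y = {x | (y - η x) + κ y * Δ x ≤ 0} := by
  ext x
  simp only [accept, mem_ofPred_eq]
  constructor <;> intro h <;> linarith

/-- On balanced sets the multiplier term is free, and the set where an integrable function is
nonpositive minimizes its integral among all measurable sets. -/
lemma setIntegral_accept_le (h : IsNestedFamily μ η Δ κ) (y : ℝ) {B : Set 𝒳}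
    (hBm : MeasurableSet B) (hB : ∫ x in B, Δ x ∂μ = 0) :
    ∫ x in accept η Δ κ y, (y - η x) ∂μ ≤ ∫ x in B, (y - η x) ∂μ := by
  rw [← h.setIntegral_score y (κ y) hB, ← h.setIntegral_score y (κ y) (h.fair y), accept_eq]
  refine setIntegral_nonpos_le hBm ?_ (h.integrable_score y (κ y))
  exact ((measurable_const.sub h.measurable_eta).add
    (h.measurable_delta.const_mul _)).stronglyMeasurable

/-- A fair set whose risk does not exceed that of the acceptance region equals it a.e. -/
lemma ae_mem_iff_mem_accept (h : IsNestedFamily μ η Δ κ) {y : ℝ}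
    (hy : μ {x | η x = y} = 0) {B : Set 𝒳}
    (hBm : MeasurableSet B) (hB : ∫ x in B, Δ x ∂μ = 0)
    (hle : ∫ x in B, (y - η x) ∂μ ≤ ∫ x in accept η Δ κ y, (y - η x) ∂μ) :
    ∀ᵐ x ∂μ, x ∈ B ↔ x ∈ accept η Δ κ y := by
  have hAm := h.measurableSet_accept y
  have hψ := h.integrable_score y (κ y)
  rw [← h.setIntegral_score y (κ y) hB, ← h.setIntegral_score y (κ y) (h.fair y),
    ← integral_indicator hBm, ← integral_indicator hAm] at hle
  -- The left side is the minimum of the score and `0`, hence pointwise below its restriction to any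
  -- set; equal integrals then force a.e. equality.
  have hge : ((accept η Δ κ y).indicator fun x => (y - η x) + κ y * Δ x) ≤ᵐ[μ]
      (B.indicator fun x => (y - η x) + κ y * Δ x) := by
    refine Eventually.of_forall fun x => ?_
    rw [accept_eq]
    by_cases hx : (y - η x) + κ y * Δ x ≤ 0
    · rw [indicator_of_mem (by exact hx)]
      by_cases hxB : x ∈ B
      · rw [indicator_of_mem hxB]
      · rwa [indicator_of_notMem hxB]
    · rw [indicator_of_notMem (by exact hx)]
      exact indicator_apply_nonneg fun _ => (not_le.1 hx).le
  have heq := (integral_eq_iff_of_ae_le (hψ.indicator hAm) (hψ.indicator hBm) hge).1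
    (le_antisymm (integral_mono_ae (hψ.indicator hAm) (hψ.indicator hBm) hge) hle)
  have hnull : ∀ᵐ x ∂μ, ¬ (η x = y + κ y * Δ x ∧ Δ x ≠ 0) := by
    rw [ae_iff]; simpa using h.null_graph y (κ y)
  have hnull' : ∀ᵐ x ∂μ, ¬ η x = y := by
    rw [ae_iff]; simpa using hy
  filter_upwards [heq, hnull, hnull'] with x hx h1 h2
  -- The two sets can differ only where the score vanishes. Where `Δ x = 0` this means `η x = y`,
  -- and elsewhere it means lying on the null graph.
  have hne : (y - η x) + κ y * Δ x ≠ 0 := by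
    intro h0
    by_cases hΔ : Δ x = 0
    · rw [hΔ] at h0; exact h2 (by linarith)
    · exact h1 ⟨by linarith, hΔ⟩
  by_cases hxA : x ∈ accept η Δ κ y <;> by_cases hxB : x ∈ B
  · exact iff_of_true hxB hxA
  · rw [indicator_of_mem hxA, indicator_of_notMem hxB] at hx
    exact absurd hx hne
  · rw [indicator_of_notMem hxA, indicator_of_mem hxB] at hx
    exact absurd hx.symm hne
  · exact iff_of_false hxB hxA

/-- For `y ∈ (0, 1]` this is the limit of the optimality of the acceptance regions. Outside, the
level set is everything or empty, which is optimal because `y - η` has constant sign. Having it for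
every `y`, not just almost every one, is what yields the classification claim. -/
lemma setIntegral_nestedSup_le (h : IsNestedFamily μ η Δ κ) (y : ℝ) {B : Set 𝒳}
    (hBm : MeasurableSet B) (hB : ∫ x in B, Δ x ∂μ = 0) :
    ∫ x in {x | y ≤ nestedSup η Δ κ x}, (y - η x) ∂μ ≤ ∫ x in B, (y - η x) ∂μ := by
  rcases le_or_gt y 0 with hy0 | hy0
  · have : {x | y ≤ nestedSup η Δ κ x} = univ :=
      eq_univ_of_forall fun x => hy0.trans (nestedSup_mem x).1
    rw [this, setIntegral_univ, ← integral_indicator hBm]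
    refine integral_mono_ae (h.integrable_sub_eta y) ((h.integrable_sub_eta y).indicator hBm) ?_
    filter_upwards [h.eta_mem] with x hx
    by_cases hxB : x ∈ B
    · rw [indicator_of_mem hxB]
    · rw [indicator_of_notMem hxB]; linarith [hx.1]
  rcases le_or_gt y 1 with hy1 | hy1
  · obtain ⟨u, -, hu, hlim⟩ := exists_seq_strictMono_tendsto' hy0
    -- The integrand moves with the level; separating `t` leaves the fixed integrands `1` and `η`.
    have split : ∀ (t : ℝ) (s : Set 𝒳),
        ∫ x in s, (t - η x) ∂μ = t * (∫ _ in s, (1 : ℝ) ∂μ) - ∫ x in s, η x ∂μ := by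
      intro t s
      rw [← integral_const_mul, ← integral_sub (by fun_prop) h.integrable_eta.integrableOn]
      simp
    have hA : Tendsto (fun n => ∫ x in accept η Δ κ (u n), (u n - η x) ∂μ) atTop
        (𝓝 (∫ x in {x | y ≤ nestedSup η Δ κ x}, (y - η x) ∂μ)) := by
      simp_rw [split]
      exact (hlim.mul (h.tendsto_setIntegral_accept ⟨hy0, hy1⟩ hu hlim (integrable_const 1))).sub
        (h.tendsto_setIntegral_accept ⟨hy0, hy1⟩ hu hlim h.integrable_eta)
    have hC : Tendsto (fun n => ∫ x in B, (u n - η x) ∂μ) atTop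
        (𝓝 (∫ x in B, (y - η x) ∂μ)) := by
      simp_rw [split]
      exact (hlim.mul_const _).sub_const _
    exact le_of_tendsto_of_tendsto' hA hC fun n => h.setIntegral_accept_le (u n) hBm hB
  · have : {x | y ≤ nestedSup η Δ κ x} = ∅ :=
      eq_empty_of_forall_notMem fun x hx => absurd (nestedSup_mem (η := η) (Δ := Δ) (κ := κ) x).2
        (not_le.2 (hy1.trans_le hx))
    rw [this, setIntegral_empty]
    refine integral_nonneg_of_ae (ae_restrict_of_ae ?_)
    filter_upwards [h.eta_mem] with x hx
    simp only [Pi.zero_apply]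
    linarith [hx.2]

end IsNestedFamily

/-! ### Fubini decomposition of the quadratic risk over levels -/

section LayerCake

variable [IsFiniteMeasure μ] {c : 𝒳 → ℝ}

lemma integrable_layer (hη : Integrable η μ) (hc : Measurable c) :
    Integrable (fun p : 𝒳 × ℝ => {p : 𝒳 × ℝ | p.2 ≤ c p.1}.indicator (fun p => p.2 - η p.1) p)
      (μ.prod (volume.restrict (Ioc (0 : ℝ) 1))) := by
  have hset : MeasurableSet {p : 𝒳 × ℝ | p.2 ≤ c p.1} :=
    measurableSet_le measurable_snd (hc.comp measurable_fst)
  refine Integrable.indicator ?_ hset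
  have hid : Integrable (fun y : ℝ => y) (volume.restrict (Ioc (0 : ℝ) 1)) :=
    (continuous_id.integrableOn_Icc (a := (0 : ℝ)) (b := 1)).mono_set Ioc_subset_Icc_self
  exact (hid.comp_snd μ).sub (hη.comp_fst _)

lemma integral_layer {c e : ℝ} (hc : c ∈ Icc (0 : ℝ) 1) :
    ∫ y in Ioc (0 : ℝ) 1, (Iic c).indicator (fun y => y - e) y = c ^ 2 / 2 - c * e := by
  rw [setIntegral_indicator measurableSet_Iic, Ioc_inter_Iic, min_eq_right hc.2,
    ← intervalIntegral.integral_of_le hc.1, intervalIntegral.integral_sub (by simp) (by simp)]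
  simp

/-- Layer-cake formula for the quadratic risk. -/
lemma integral_sq_sub_eq_layer (hη : Integrable η μ) (hc : Measurable c)
    (hc01 : ∀ x, c x ∈ Icc (0 : ℝ) 1) :
    ∫ x, (c x ^ 2 / 2 - c x * η x) ∂μ =
      ∫ y in Ioc (0 : ℝ) 1, ∫ x in {x | y ≤ c x}, (y - η x) ∂μ := by
  have hswap := integral_integral_swap (f := fun x y =>
    {p : 𝒳 × ℝ | p.2 ≤ c p.1}.indicator (fun p => p.2 - η p.1) (x, y))
    (integrable_layer hη hc)
  have h1 : ∀ x, ∫ y in Ioc (0 : ℝ) 1,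
      {p : 𝒳 × ℝ | p.2 ≤ c p.1}.indicator (fun p => p.2 - η p.1) (x, y) =
        c x ^ 2 / 2 - c x * η x := fun x => integral_layer (e := η x) (hc01 x)
  have h2 : ∀ y, ∫ x, {p : 𝒳 × ℝ | p.2 ≤ c p.1}.indicator (fun p => p.2 - η p.1) (x, y) ∂μ =
      ∫ x in {x | y ≤ c x}, (y - η x) ∂μ := fun y => by
    rw [← integral_indicator (measurableSet_le measurable_const hc)]
    rfl
  simpa only [h1, h2] using hswap

lemma integrable_layer_right (hη : Integrable η μ) (hc : Measurable c) :
    IntegrableOn (fun y => ∫ x in {x | y ≤ c x}, (y - η x) ∂μ) (Ioc (0 : ℝ) 1) := by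
  refine (integrable_layer hη hc).integral_prod_right.congr (Eventually.of_forall fun y => ?_)
  dsimp only
  rw [← integral_indicator (measurableSet_le measurable_const hc)]
  rfl

/-- A set of full Lebesgue measure is dense, so it contains a countable dense set of levels.
Countability puts all their exceptional sets into one null set, and density places a level between
`d x` and `c x` whenever `d x < c x`. -/
lemma ae_le_of_ae_level_imp {c d : 𝒳 → ℝ} (hc : ∀ x, c x ∈ Icc (0 : ℝ) 1)
    (hd : ∀ x, d x ∈ Icc (0 : ℝ) 1)
    (h : ∀ᵐ y : ℝ, y ∈ Ioc (0 : ℝ) 1 → ∀ᵐ x ∂μ, y ≤ c x → y ≤ d x) : c ≤ᵐ[μ] d := by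
  obtain ⟨t, hts, htc, htd⟩ := (Measure.dense_of_ae h).exists_countable_dense_subset
  have : ∀ᵐ x ∂μ, ∀ y ∈ t, y ∈ Ioc (0 : ℝ) 1 → y ≤ c x → y ≤ d x := by
    rw [ae_ball_iff htc]
    intro y hy
    by_cases hy1 : y ∈ Ioc (0 : ℝ) 1
    · filter_upwards [hts hy hy1] with x hx _ using hx
    · exact Eventually.of_forall fun x hx => absurd hx hy1
  filter_upwards [this] with x hx
  by_contra! hlt
  obtain ⟨y, hyt, hy⟩ := htd.exists_between hlt
  exact absurd (hx y hyt ⟨(hd x).1.trans_lt hy.1, hy.2.le.trans (hc x).2⟩ hy.2.le) (not_le.2 hy.1)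

end LayerCake

/-! ### Optimality and uniqueness among functions with values in the unit interval -/

namespace IsNestedFamily

variable [IsFiniteMeasure μ] {c : 𝒳 → ℝ}

lemma integral_nestedSup_le (h : IsNestedFamily μ η Δ κ) (hc : Measurable c)
    (hc01 : ∀ x, c x ∈ Icc (0 : ℝ) 1) (hfair : LevelFair μ Δ c) :
    ∫ x, (nestedSup η Δ κ x ^ 2 / 2 - nestedSup η Δ κ x * η x) ∂μ ≤
      ∫ x, (c x ^ 2 / 2 - c x * η x) ∂μ := by
  rw [integral_sq_sub_eq_layer h.integrable_eta h.measurable_nestedSup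
    nestedSup_mem, integral_sq_sub_eq_layer h.integrable_eta hc hc01]
  exact integral_mono
    (integrable_layer_right h.integrable_eta h.measurable_nestedSup)
    (integrable_layer_right h.integrable_eta hc)
    fun y => h.setIntegral_nestedSup_le y (measurableSet_le measurable_const hc) (hfair y)

lemma ae_eq_nestedSup (h : IsNestedFamily μ η Δ κ) (hc : Measurable c)
    (hc01 : ∀ x, c x ∈ Icc (0 : ℝ) 1) (hfair : LevelFair μ Δ c)
    (hle : ∫ x, (c x ^ 2 / 2 - c x * η x) ∂μ ≤
      ∫ x, (nestedSup η Δ κ x ^ 2 / 2 - nestedSup η Δ κ x * η x) ∂μ) :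
    c =ᵐ[μ] nestedSup η Δ κ := by
  have hsm := h.measurable_nestedSup
  have hLm : ∀ y, MeasurableSet {x | y ≤ nestedSup η Δ κ x} :=
    fun y => measurableSet_le measurable_const hsm
  have hCm : ∀ y, MeasurableSet {x | y ≤ c x} := fun y => measurableSet_le measurable_const hc
  have heq := le_antisymm (h.integral_nestedSup_le hc hc01 hfair) hle
  rw [integral_sq_sub_eq_layer h.integrable_eta hsm nestedSup_mem,
    integral_sq_sub_eq_layer h.integrable_eta hc hc01,
    integral_eq_iff_of_ae_le (integrable_layer_right h.integrable_eta hsm)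
      (integrable_layer_right h.integrable_eta hc)
      (Eventually.of_forall fun y => h.setIntegral_nestedSup_le y (hCm y) (hfair y))] at heq
  -- A finite measure charges at most countably many level sets of `η`.
  have hcount : ∀ᵐ y : ℝ, μ {x | η x = y} = 0 := by
    have := (Measure.countable_meas_level_set_pos (μ := μ) h.measurable_eta).ae_notMem volume
    filter_upwards [this] with y hy
    simpa using hy
  have key : ∀ᵐ y : ℝ, y ∈ Ioc (0 : ℝ) 1 → ∀ᵐ x ∂μ, y ≤ c x ↔ y ≤ nestedSup η Δ κ x := by
    rw [Filter.EventuallyEq, ae_restrict_iff' measurableSet_Ioc] at heq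
    filter_upwards [heq, hcount] with y hy hy0 hy01
    -- The acceptance region is itself a balanced competitor, so both level sets do at least as well
    -- and each coincides with it a.e.
    have hL := h.setIntegral_nestedSup_le y (h.measurableSet_accept y) (h.fair y)
    filter_upwards [h.ae_mem_iff_mem_accept hy0 (hLm y) (h.levelFair_nestedSup y) hL,
      h.ae_mem_iff_mem_accept hy0 (hCm y) (hfair y) ((hy hy01).symm.le.trans hL)] with x h1 h2
    exact h2.trans h1.symm
  refine (ae_le_of_ae_level_imp hc01 nestedSup_mem ?_).antisymm
    (ae_le_of_ae_level_imp nestedSup_mem hc01 ?_)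
  · filter_upwards [key] with y hy hy01
    filter_upwards [hy hy01] with x hx using hx.1
  · filter_upwards [key] with y hy hy01
    filter_upwards [hy hy01] with x hx using hx.2

end IsNestedFamily

end NestedFamily

variable {Ω 𝒳 : Type*} [MeasurableSpace Ω] [MeasurableSpace 𝒳]
  {P : Measure Ω} [IsProbabilityMeasure P] {X : Ω → 𝒳} {S : Ω → Fin 2} {Y : Ω → ℝ}

/-! ### Both risks expressed through the Bayes regression function -/

section Bayes

lemma isProbabilityMeasure_featureLaw (hX : Measurable X) :
    IsProbabilityMeasure (featureLaw P X) := Measure.isProbabilityMeasure_map hX.aemeasurable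

lemma measurable_bayesRegression : Measurable (bayesRegression P X Y) := by
  have : StronglyMeasurable fun x => ∫ t, t ∂(condDistrib Y X P x) :=
    (stronglyMeasurable_id (α := ℝ)).integral_kernel
  exact this.measurable

/-- The joint law is concentrated on responses in `[0, 1]`, hence so are almost all conditional
laws, and their means lie there too. -/
lemma bayesRegression_mem (hX : Measurable X) (hY : Measurable Y)
    (hY01 : ∀ᵐ ω ∂P, Y ω = 0 ∨ Y ω = 1) :
    ∀ᵐ x ∂(featureLaw P X), bayesRegression P X Y x ∈ Icc (0 : ℝ) 1 := by
  change ∀ᵐ x ∂(P.map X), _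
  have h1 : ∀ᵐ p ∂((P.map X) ⊗ₘ condDistrib Y X P), p.2 ∈ Icc (0 : ℝ) 1 := by
    rw [compProd_map_condDistrib hY.aemeasurable,
      ae_map_iff (hX.prodMk hY).aemeasurable (measurable_snd measurableSet_Icc)]
    filter_upwards [hY01] with ω hω
    rcases hω with h | h <;> simp [h]
  filter_upwards [Measure.ae_ae_of_ae_compProd h1] with x hx
  have hint : Integrable (fun t : ℝ => t) (condDistrib Y X P x) := by
    refine Integrable.of_bound measurable_id.aestronglyMeasurable 1 ?_
    filter_upwards [hx] with t ht
    rw [Real.norm_eq_abs, abs_of_nonneg ht.1]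
    exact ht.2
  refine ⟨integral_nonneg_of_ae ?_, ?_⟩
  · filter_upwards [hx] with t ht using ht.1
  · calc bayesRegression P X Y x ≤ ∫ _, (1 : ℝ) ∂(condDistrib Y X P x) := by
          refine integral_mono_ae hint (integrable_const _) ?_
          filter_upwards [hx] with t ht using ht.2
      _ = 1 := by simp

lemma integrable_response (hY : Measurable Y) (hY01 : ∀ᵐ ω ∂P, Y ω = 0 ∨ Y ω = 1) :
    Integrable Y P := by
  refine Integrable.of_bound hY.aestronglyMeasurable 1 ?_
  filter_upwards [hY01] with ω hω
  rcases hω with h | h <;> simp [h]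

lemma integrable_comp_of_mem (hX : Measurable X) {φ : 𝒳 → ℝ} (hφ : Measurable φ)
    (hφ01 : ∀ x, φ x ∈ Icc (0 : ℝ) 1) : Integrable (fun ω => φ (X ω)) P := by
  refine Integrable.of_bound (hφ.comp hX).aestronglyMeasurable 1 (Eventually.of_forall fun ω => ?_)
  rw [Real.norm_eq_abs, abs_of_nonneg (hφ01 _).1]
  exact (hφ01 _).2

lemma integrable_comp_mul_response (hX : Measurable X) (hY : Measurable Y)
    (hY01 : ∀ᵐ ω ∂P, Y ω = 0 ∨ Y ω = 1) {φ : 𝒳 → ℝ} (hφ : Measurable φ)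
    (hφ01 : ∀ x, φ x ∈ Icc (0 : ℝ) 1) : Integrable (fun ω => φ (X ω) * Y ω) P := by
  refine (integrable_response hY hY01).bdd_mul (c := 1) (hφ.comp hX).aestronglyMeasurable
    (Eventually.of_forall fun ω => ?_)
  rw [Real.norm_eq_abs, abs_of_nonneg (hφ01 _).1]
  exact (hφ01 _).2

lemma integral_comp_mul_response (hX : Measurable X) (hY : Measurable Y)
    (hY01 : ∀ᵐ ω ∂P, Y ω = 0 ∨ Y ω = 1) {φ : 𝒳 → ℝ} (hφ : Measurable φ)
    (hφ01 : ∀ x, φ x ∈ Icc (0 : ℝ) 1) :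
    ∫ ω, φ (X ω) * Y ω ∂P = ∫ x, φ x * bayesRegression P X Y x ∂(featureLaw P X) := by
  have hm : Measurable fun p : 𝒳 × ℝ => φ p.1 * p.2 :=
    (hφ.comp measurable_fst).mul measurable_snd
  have hXY : AEMeasurable (fun ω => (X ω, Y ω)) P := (hX.prodMk hY).aemeasurable
  have hint : Integrable (fun p : 𝒳 × ℝ => φ p.1 * p.2)
      ((P.map X) ⊗ₘ condDistrib Y X P) := by
    rw [compProd_map_condDistrib hY.aemeasurable,
      integrable_map_measure hm.aestronglyMeasurable hXY]
    exact integrable_comp_mul_response hX hY hY01 hφ hφ01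
  calc ∫ ω, φ (X ω) * Y ω ∂P = ∫ p, φ p.1 * p.2 ∂(P.map fun ω => (X ω, Y ω)) :=
        (integral_map hXY hm.aestronglyMeasurable).symm
    _ = ∫ x, ∫ t, φ x * t ∂(condDistrib Y X P x) ∂(P.map X) := by
        rw [← compProd_map_condDistrib hY.aemeasurable, Measure.integral_compProd hint]
    _ = ∫ x, φ x * bayesRegression P X Y x ∂(featureLaw P X) := by
        refine integral_congr_ae (Eventually.of_forall fun x => ?_)
        exact integral_const_mul _ _

lemma integrable_bayesRegression (hX : Measurable X) (hY : Measurable Y)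
    (hY01 : ∀ᵐ ω ∂P, Y ω = 0 ∨ Y ω = 1) :
    Integrable (bayesRegression P X Y) (featureLaw P X) := by
  have := isProbabilityMeasure_featureLaw (P := P) hX
  refine Integrable.of_bound measurable_bayesRegression.aestronglyMeasurable 1 ?_
  filter_upwards [bayesRegression_mem hX hY hY01] with x hx
  rw [Real.norm_eq_abs, abs_of_nonneg hx.1]
  exact hx.2

lemma integrable_of_mem {μ : Measure 𝒳} [IsFiniteMeasure μ] {φ : 𝒳 → ℝ} (hφ : Measurable φ)
    (hφ01 : ∀ x, φ x ∈ Icc (0 : ℝ) 1) : Integrable φ μ := by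
  refine Integrable.of_bound hφ.aestronglyMeasurable 1 (Eventually.of_forall fun x => ?_)
  rw [Real.norm_eq_abs, abs_of_nonneg (hφ01 _).1]
  exact (hφ01 _).2

lemma integrable_mul_bayesRegression (hX : Measurable X) (hY : Measurable Y)
    (hY01 : ∀ᵐ ω ∂P, Y ω = 0 ∨ Y ω = 1) {φ : 𝒳 → ℝ} (hφ : Measurable φ)
    (hφ01 : ∀ x, φ x ∈ Icc (0 : ℝ) 1) :
    Integrable (fun x => φ x * bayesRegression P X Y x) (featureLaw P X) := by
  refine (integrable_bayesRegression hX hY hY01).bdd_mul (c := 1) hφ.aestronglyMeasurable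
    (Eventually.of_forall fun x => ?_)
  rw [Real.norm_eq_abs, abs_of_nonneg (hφ01 _).1]
  exact (hφ01 _).2

/-- Expand the square and use `Y² = Y`. -/
lemma response_sub_sq_ae_eq (hY01 : ∀ᵐ ω ∂P, Y ω = 0 ∨ Y ω = 1) (c : 𝒳 → ℝ) :
    (fun ω => (Y ω - c (X ω)) ^ 2) =ᵐ[P]
      fun ω => Y ω + c (X ω) ^ 2 - 2 * (c (X ω) * Y ω) := by
  filter_upwards [hY01] with ω hω
  rcases hω with h | h <;> rw [h] <;> ring

lemma sq_mem_of_mem {t : ℝ} (ht : t ∈ Icc (0 : ℝ) 1) : t ^ 2 ∈ Icc (0 : ℝ) 1 :=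
  ⟨sq_nonneg _, pow_le_one₀ ht.1 ht.2⟩

lemma integrable_add_sq (hX : Measurable X) (hY : Measurable Y)
    (hY01 : ∀ᵐ ω ∂P, Y ω = 0 ∨ Y ω = 1) {c : 𝒳 → ℝ} (hc : Measurable c)
    (hc01 : ∀ x, c x ∈ Icc (0 : ℝ) 1) : Integrable (fun ω => Y ω + c (X ω) ^ 2) P :=
  (integrable_response hY hY01).add
    (integrable_comp_of_mem hX (hc.pow_const 2) fun x => sq_mem_of_mem (hc01 x))

/-- The squared error, up to the variance of the response, in terms of the Bayes regression. -/
lemma integral_response_sub_sq (hX : Measurable X) (hY : Measurable Y)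
    (hY01 : ∀ᵐ ω ∂P, Y ω = 0 ∨ Y ω = 1) {c : 𝒳 → ℝ} (hc : Measurable c)
    (hc01 : ∀ x, c x ∈ Icc (0 : ℝ) 1) :
    ∫ ω, (Y ω - c (X ω)) ^ 2 ∂P = ∫ ω, Y ω ∂P +
      2 * ∫ x, (c x ^ 2 / 2 - c x * bayesRegression P X Y x) ∂(featureLaw P X) := by
  have := isProbabilityMeasure_featureLaw (P := P) hX
  have hc2 := fun x => sq_mem_of_mem (hc01 x)
  have hmap : ∫ ω, c (X ω) ^ 2 ∂P = ∫ x, c x ^ 2 ∂(featureLaw P X) :=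
    (integral_map hX.aemeasurable (hc.pow_const 2).aestronglyMeasurable).symm
  rw [integral_congr_ae (response_sub_sq_ae_eq hY01 c),
    integral_sub (integrable_add_sq hX hY hY01 hc hc01)
      ((integrable_comp_mul_response hX hY hY01 hc hc01).const_mul 2),
    integral_add (integrable_response hY hY01)
      (integrable_comp_of_mem hX (hc.pow_const 2) hc2), integral_const_mul,
    integral_comp_mul_response hX hY hY01 hc hc01,
    integral_sub ((integrable_of_mem (hc.pow_const 2) hc2).div_const 2)
      (integrable_mul_bayesRegression hX hY hY01 hc hc01), integral_div, hmap]
  ring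

lemma quadraticRisk_eq (hX : Measurable X) (hY : Measurable Y)
    (hY01 : ∀ᵐ ω ∂P, Y ω = 0 ∨ Y ω = 1) {c : 𝒳 → ℝ} (hc : Measurable c)
    (hc01 : ∀ x, c x ∈ Icc (0 : ℝ) 1) :
    quadraticRisk P X Y c = ENNReal.ofReal (∫ ω, (Y ω - c (X ω)) ^ 2 ∂P) := by
  refine (ofReal_integral_eq_lintegral_ofReal ?_
    (Eventually.of_forall fun ω => sq_nonneg _)).symm
  exact ((integrable_add_sq hX hY hY01 hc hc01).sub
    ((integrable_comp_mul_response hX hY hY01 hc hc01).const_mul 2)).congr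
      (response_sub_sq_ae_eq hY01 c).symm

/-- For binary values, `y (g - gY) + (1 - y)(Y - gY) = g (y - Y) + (1 - y) Y`; conditioning on `X`
replaces `Y` by `η` in the first term, and the second does not depend on `g`. -/
lemma costRisk_eq (hX : Measurable X) (hY : Measurable Y)
    (hY01 : ∀ᵐ ω ∂P, Y ω = 0 ∨ Y ω = 1) {g : 𝒳 → ℝ} (hg : IsClassifier g) (y : ℝ) :
    costRisk P X Y y g = ∫ x in {x | 1 ≤ g x}, (y - bayesRegression P X Y x) ∂(featureLaw P X) +
      (1 - y) * ∫ ω, Y ω ∂P := by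
  obtain ⟨hgm, hg01⟩ := hg
  have := isProbabilityMeasure_featureLaw (P := P) hX
  have hgI : ∀ x, g x ∈ Icc (0 : ℝ) 1 := fun x => by rcases hg01 x with h | h <;> simp [h]
  have hi1 := integrable_response hY hY01
  have hi2 : Integrable (fun ω => g (X ω)) P := integrable_comp_of_mem hX hgm hgI
  have hi3 := integrable_comp_mul_response hX hY hY01 hgm hgI
  have h0 : P.real {ω | Y ω = 0 ∧ g (X ω) = 1} = ∫ ω, (g (X ω) - g (X ω) * Y ω) ∂P := by
    have hs : MeasurableSet {ω | Y ω = 0 ∧ g (X ω) = 1} :=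
      (measurableSet_eq_fun hY measurable_const).inter
        (measurableSet_eq_fun (hgm.comp hX) measurable_const)
    rw [← integral_indicator_one hs]
    refine integral_congr_ae ?_
    filter_upwards [hY01] with ω hω
    rcases hω with h | h <;> rcases hg01 (X ω) with h' | h' <;> simp [h, h']
  have h1 : P.real {ω | Y ω = 1 ∧ g (X ω) = 0} = ∫ ω, (Y ω - g (X ω) * Y ω) ∂P := by
    have hs : MeasurableSet {ω | Y ω = 1 ∧ g (X ω) = 0} :=
      (measurableSet_eq_fun hY measurable_const).inter
        (measurableSet_eq_fun (hgm.comp hX) measurable_const)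
    rw [← integral_indicator_one hs]
    refine integral_congr_ae ?_
    filter_upwards [hY01] with ω hω
    rcases hω with h | h <;> rcases hg01 (X ω) with h' | h' <;> simp [h, h']
  have hmap : ∫ ω, g (X ω) ∂P = ∫ x, g x ∂(featureLaw P X) :=
    (integral_map hX.aemeasurable hgm.aestronglyMeasurable).symm
  have hset : ∫ x in {x | 1 ≤ g x}, (y - bayesRegression P X Y x) ∂(featureLaw P X) =
      ∫ x, (y * g x - g x * bayesRegression P X Y x) ∂(featureLaw P X) := by
    rw [← integral_indicator (measurableSet_le measurable_const hgm)]
    refine integral_congr_ae (Eventually.of_forall fun x => ?_)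
    rcases hg01 x with h' | h' <;> simp [h']
  rw [costRisk, h0, h1, hset, integral_sub hi2 hi3, integral_sub hi1 hi3,
    integral_sub ((integrable_of_mem hgm hgI).const_mul y)
      (integrable_mul_bayesRegression hX hY hY01 hgm hgI), integral_const_mul, hmap,
    integral_comp_mul_response hX hY hY01 hgm hgI]
  ring

end Bayes

/-! ### The Jordan parts and the density `Δ` -/

section Jordan

lemma jordan_eq (ν₁ ν₂ : Measure 𝒳) [IsFiniteMeasure ν₁] [IsFiniteMeasure ν₂] :
    jordan ν₁ ν₂ = Measure.jordanDecompositionOfToSignedMeasureSub ν₁ ν₂ :=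
  Measure.toJordanDecomposition_toSignedMeasure_sub

lemma groupLaw_apply (hX : Measurable X) (hS : Measurable S) (s : Fin 2) {A : Set 𝒳}
    (hA : MeasurableSet A) :
    groupLaw P X S s A = (P (S ⁻¹' {s}))⁻¹ * P (S ⁻¹' {s} ∩ X ⁻¹' A) := by
  rw [groupLaw, Measure.map_apply hX hA, cond_apply (hS (measurableSet_singleton s))]

lemma isProbabilityMeasure_groupLaw (hX : Measurable X) {s : Fin 2}
    (hpos : 0 < P (S ⁻¹' {s})) : IsProbabilityMeasure (groupLaw P X S s) := by
  have := cond_isProbabilityMeasure hpos.ne'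
  exact Measure.isProbabilityMeasure_map hX.aemeasurable

lemma groupLaw_absolutelyContinuous (hX : Measurable X) (s : Fin 2) :
    groupLaw P X S s ≪ featureLaw P X :=
  Measure.AbsolutelyContinuous.map cond_absolutelyContinuous hX

lemma muPlus_eq : muPlus P X S = (jordanMass P X S)⁻¹ • (groupLaw P X S 0 - groupLaw P X S 1) := by
  rw [muPlus, jordan_eq, Measure.jordanDecompositionOfToSignedMeasureSub_posPart]

lemma muMinus_eq :
    muMinus P X S = (jordanMass P X S)⁻¹ • (groupLaw P X S 1 - groupLaw P X S 0) := by
  rw [muMinus, jordan_eq, Measure.jordanDecompositionOfToSignedMeasureSub_negPart]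

lemma muPlus_absolutelyContinuous (hX : Measurable X) : muPlus P X S ≪ featureLaw P X := by
  rw [muPlus_eq]
  exact ((Measure.absolutelyContinuous_of_le Measure.sub_le).trans
    (groupLaw_absolutelyContinuous hX 0)).smul_left _

lemma muMinus_absolutelyContinuous (hX : Measurable X) : muMinus P X S ≪ featureLaw P X := by
  rw [muMinus_eq]
  exact ((Measure.absolutelyContinuous_of_le Measure.sub_le).trans
    (groupLaw_absolutelyContinuous hX 1)).smul_left _

lemma real_sub_sub_real_sub (ν₁ ν₂ : Measure 𝒳) [IsFiniteMeasure ν₁] [IsFiniteMeasure ν₂]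
    {A : Set 𝒳} (hA : MeasurableSet A) :
    (ν₁ - ν₂).real A - (ν₂ - ν₁).real A = ν₁.real A - ν₂.real A := by
  have h := congrArg (fun s : SignedMeasure 𝒳 => s A)
    (Measure.sub_toSignedMeasure_eq_toSignedMeasure_sub (μ := ν₁) (ν := ν₂))
  simpa [Measure.toSignedMeasure_apply_measurable hA] using h.symm

lemma jordanMass_ne_top : jordanMass P X S ≠ ⊤ := measure_ne_top _ _

/-- Both group laws have mass one, so their Jordan parts have equal mass; if one part vanished, so
would the other, and the laws would agree. -/
lemma jordanMass_ne_zero (hX : Measurable X) (hpos : ∀ s : Fin 2, 0 < P (S ⁻¹' {s}))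
    (hne : groupLaw P X S 0 ≠ groupLaw P X S 1) : jordanMass P X S ≠ 0 := by
  intro h
  have := isProbabilityMeasure_groupLaw hX (hpos 0)
  have := isProbabilityMeasure_groupLaw hX (hpos 1)
  rw [jordanMass, jordan_eq, Measure.jordanDecompositionOfToSignedMeasureSub_posPart,
    Measure.measure_univ_eq_zero] at h
  have h1 := real_sub_sub_real_sub (groupLaw P X S 0) (groupLaw P X S 1) MeasurableSet.univ
  have h2 : groupLaw P X S 1 - groupLaw P X S 0 = 0 := by
    rw [h] at h1
    rw [← Measure.measure_univ_eq_zero, ← measureReal_eq_zero_iff]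
    simpa using h1
  refine hne (Measure.ext fun A hA => ?_)
  have h3 := real_sub_sub_real_sub (groupLaw P X S 0) (groupLaw P X S 1) hA
  rw [h, h2, sub_self, eq_comm, sub_eq_zero] at h3
  exact (measureReal_eq_measureReal_iff).1 h3

lemma isFiniteMeasure_muPlus (h0 : jordanMass P X S ≠ 0) : IsFiniteMeasure (muPlus P X S) :=
  Measure.smul_finite _ (ENNReal.inv_ne_top.2 h0)

lemma isFiniteMeasure_muMinus (h0 : jordanMass P X S ≠ 0) : IsFiniteMeasure (muMinus P X S) :=
  Measure.smul_finite _ (ENNReal.inv_ne_top.2 h0)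

lemma measurable_Delta : Measurable (Delta P X S) :=
  (Measure.measurable_rnDeriv _ _).ennreal_toReal.sub
    (Measure.measurable_rnDeriv _ _).ennreal_toReal

lemma integrable_Delta (h0 : jordanMass P X S ≠ 0) :
    Integrable (Delta P X S) (featureLaw P X) := by
  have := isFiniteMeasure_muPlus h0
  have := isFiniteMeasure_muMinus h0
  exact Measure.integrable_toReal_rnDeriv.sub Measure.integrable_toReal_rnDeriv

lemma setIntegral_Delta (hX : Measurable X) (h0 : jordanMass P X S ≠ 0) (A : Set 𝒳) :
    ∫ x in A, Delta P X S x ∂(featureLaw P X) = (muPlus P X S).real A - (muMinus P X S).real A := by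
  have := isFiniteMeasure_muPlus h0
  have := isFiniteMeasure_muMinus h0
  have := isProbabilityMeasure_featureLaw (P := P) hX
  rw [← Measure.setIntegral_toReal_rnDeriv (muPlus_absolutelyContinuous hX) A,
    ← Measure.setIntegral_toReal_rnDeriv (muMinus_absolutelyContinuous hX) A,
    ← integral_sub Measure.integrable_toReal_rnDeriv.integrableOn
      Measure.integrable_toReal_rnDeriv.integrableOn]
  rfl

lemma setIntegral_Delta_eq_zero_iff (hX : Measurable X) (h0 : jordanMass P X S ≠ 0) {A : Set 𝒳}
    (hA : MeasurableSet A) :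
    ∫ x in A, Delta P X S x ∂(featureLaw P X) = 0 ↔ groupLaw P X S 0 A = groupLaw P X S 1 A := by
  rw [setIntegral_Delta hX h0, muPlus_eq, muMinus_eq, measureReal_ennreal_smul_apply,
    measureReal_ennreal_smul_apply, ← mul_sub, real_sub_sub_real_sub _ _ hA, mul_eq_zero,
    sub_eq_zero, measureReal_eq_measureReal_iff, or_iff_right]
  exact ENNReal.toReal_ne_zero.2
    ⟨ENNReal.inv_ne_zero.2 jordanMass_ne_top, ENNReal.inv_ne_top.2 h0⟩

/-- A set that is null for both Jordan parts is null for `μ` off `{Δ = 0}`. -/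
lemma measure_inter_Delta_ne_zero (hX : Measurable X) (h0 : jordanMass P X S ≠ 0) {N : Set 𝒳}
    (hp : muPlus P X S N = 0) (hm : muMinus P X S N = 0) :
    featureLaw P X (N ∩ {x | Delta P X S x ≠ 0}) = 0 := by
  have := isFiniteMeasure_muPlus h0
  have := isFiniteMeasure_muMinus h0
  have := isProbabilityMeasure_featureLaw (P := P) hX
  -- The density of a measure vanishes a.e. on its null sets; applied to both parts, this gives `Δ =
  -- 0` a.e. on `N`.
  have key : ∀ ν : Measure 𝒳, IsFiniteMeasure ν → ν N = 0 →
      ∀ᵐ x ∂((featureLaw P X).restrict N), ν.rnDeriv (featureLaw P X) x = 0 := by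
    intro ν _ hν
    have h : ∫⁻ x in N, ν.rnDeriv (featureLaw P X) x ∂(featureLaw P X) = 0 :=
      nonpos_iff_eq_zero.1 ((Measure.setLIntegral_rnDeriv_le N).trans hν.le)
    exact (lintegral_eq_zero_iff (Measure.measurable_rnDeriv _ _)).1 h
  have hz : ∀ᵐ x ∂((featureLaw P X).restrict N), Delta P X S x = 0 := by
    filter_upwards [key _ ‹_› hp, key _ ‹_› hm] with x h1 h2
    simp [Delta, h1, h2]
  have hms : MeasurableSet {x | Delta P X S x ≠ 0} :=
    (measurableSet_eq_fun measurable_Delta measurable_const).compl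
  rw [inter_comm, ← Measure.restrict_apply hms]
  exact hz

end Jordan

/-! ### Demographic parity as balance of level sets -/

section Parity

lemma groupLaw_preimage_eq (hX : Measurable X) (hS : Measurable S)
    (hpos : ∀ s : Fin 2, 0 < P (S ⁻¹' {s})) {f : 𝒳 → ℝ} (hf : Measurable f)
    (hdp : DemographicParity P X S f) (s : Fin 2) {B : Set ℝ} (hB : MeasurableSet B) :
    groupLaw P X S s (f ⁻¹' B) = P ((fun ω => f (X ω)) ⁻¹' B) := by
  have h := hdp.measure_inter_preimage_eq_mul B {s} hB (measurableSet_singleton s)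
  rw [groupLaw_apply hX hS s (hf hB), inter_comm]
  change _ * P ((fun ω => f (X ω)) ⁻¹' B ∩ S ⁻¹' {s}) = _
  rw [h, mul_comm (P _) (P (S ⁻¹' {s})), ← mul_assoc,
    ENNReal.inv_mul_cancel (hpos s).ne' (measure_ne_top _ _), one_mul]

/-- If the two conditional laws of `f(X)` agree, their common value is also the unconditional law,
by total probability over the two groups; it remains to check the four subsets of `Fin 2`. -/
lemma demographicParity_of_map_eq (hX : Measurable X) (hS : Measurable S)
    (hpos : ∀ s : Fin 2, 0 < P (S ⁻¹' {s})) {f : 𝒳 → ℝ} (hf : Measurable f)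
    (hmap : (groupLaw P X S 0).map f = (groupLaw P X S 1).map f) :
    DemographicParity P X S f := by
  have hU : ∀ B, MeasurableSet B → ∀ s, P ((fun ω => f (X ω)) ⁻¹' B ∩ S ⁻¹' {s}) =
      P (S ⁻¹' {s}) * (groupLaw P X S 0).map f B := by
    intro B hB s
    have hs : (groupLaw P X S 0).map f B = groupLaw P X S s (f ⁻¹' B) := by
      fin_cases s
      · exact Measure.map_apply hf hB
      · rw [hmap]; exact Measure.map_apply hf hB
    rw [hs, groupLaw_apply hX hS s (hf hB), ← mul_assoc,
      ENNReal.mul_inv_cancel (hpos s).ne' (measure_ne_top _ _), one_mul, inter_comm]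
    rfl
  have hsum : ∀ E : Set Ω, P E = P (E ∩ S ⁻¹' {0}) + P (E ∩ S ⁻¹' {1}) := by
    intro E
    rw [← measure_inter_add_sdiff E (hS (measurableSet_singleton 0))]
    congr 2
    ext ω
    simp only [Set.mem_sdiff, mem_inter_iff, mem_preimage, mem_singleton_iff]
    have : S ω ≠ 0 ↔ S ω = 1 := by omega
    rw [← this]
  have htot : ∀ B, MeasurableSet B →
      P ((fun ω => f (X ω)) ⁻¹' B) = (groupLaw P X S 0).map f B := by
    intro B hB
    have h1 := hsum univ
    simp only [univ_inter, measure_univ] at h1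
    rw [hsum, hU B hB, hU B hB, ← add_mul, ← h1, one_mul]
  rw [DemographicParity, indepFun_iff_measure_inter_preimage_eq_mul]
  intro B T hB _
  by_cases t0 : (0 : Fin 2) ∈ T <;> by_cases t1 : (1 : Fin 2) ∈ T
  · have : T = univ := eq_univ_of_forall fun s => by fin_cases s <;> assumption
    simp [this]
  · have : T = {0} := by
      ext s; fin_cases s <;> simp [t0, t1]
    rw [this, hU B hB, htot B hB, mul_comm]
  · have : T = {1} := by
      ext s; fin_cases s <;> simp [t0, t1]
    rw [this, hU B hB, htot B hB, mul_comm]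
  · have : T = ∅ := by
      ext s; fin_cases s <;> simp [t0, t1]
    simp [this]

/-- Demographic parity means that all upper level sets are balanced with respect to `Δ`. -/
lemma demographicParity_iff_levelFair (hX : Measurable X) (hS : Measurable S)
    (hpos : ∀ s : Fin 2, 0 < P (S ⁻¹' {s})) (h0 : jordanMass P X S ≠ 0) {f : 𝒳 → ℝ}
    (hf : Measurable f) :
    DemographicParity P X S f ↔ LevelFair (featureLaw P X) (Delta P X S) f := by
  have hlev : ∀ y : ℝ, {x | y ≤ f x} = f ⁻¹' Ici y := fun y => rfl
  constructor
  · intro h y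
    rw [setIntegral_Delta_eq_zero_iff hX h0 (measurableSet_le measurable_const hf), hlev,
      groupLaw_preimage_eq hX hS hpos hf h 0 measurableSet_Ici,
      groupLaw_preimage_eq hX hS hpos hf h 1 measurableSet_Ici]
  · intro h
    -- Closed upper half-lines determine a finite measure on `ℝ`.
    refine demographicParity_of_map_eq hX hS hpos hf (Measure.ext_of_Ici _ _ fun y => ?_)
    rw [Measure.map_apply hf measurableSet_Ici, Measure.map_apply hf measurableSet_Ici, ← hlev,
      ← setIntegral_Delta_eq_zero_iff hX h0 (measurableSet_le measurable_const hf)]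
    exact h y

lemma DemographicParity.comp {f : 𝒳 → ℝ} (h : DemographicParity P X S f) {φ : ℝ → ℝ}
    (hφ : Measurable φ) : DemographicParity P X S fun x => φ (f x) :=
  IndepFun.comp (ψ := id) h hφ measurable_id

end Parity

/-! ### Verification of the nested family, truncation, and the theorem -/

section Main

/-- Regularity is needed only for affine graphs `d ↦ y + c d`. Nullity under both Jordan parts
becomes `μ`-nullity where `Δ ≠ 0`. -/
lemma measure_graph_eq_zero (hX : Measurable X) (h0 : jordanMass P X S ≠ 0)
    (hgraph : GraphAssumption P X S Y) (y c : ℝ) :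
    featureLaw P X {x | bayesRegression P X Y x = y + c * Delta P X S x ∧ Delta P X S x ≠ 0} = 0 := by
  have hF : Measurable fun d : {d : ℝ // d ≠ 0} => y + c * (d : ℝ) :=
    measurable_const.add (measurable_subtype_coe.const_mul c)
  have hm : Measurable fun x => (bayesRegression P X Y x, Delta P X S x) :=
    measurable_bayesRegression.prodMk measurable_Delta
  have hp := Measure.preimage_null_of_map_null hm.aemeasurable (hgraph.1 _ hF)
  have hn := Measure.preimage_null_of_map_null hm.aemeasurable (hgraph.2 _ hF)
  refine measure_mono_null ?_ (measure_inter_Delta_ne_zero hX h0 hp hn)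
  rintro x ⟨hx, hΔ⟩
  exact ⟨⟨⟨Delta P X S x, hΔ⟩, Prod.ext hx.symm rfl⟩, hΔ⟩

lemma isNestedFamily (hX : Measurable X) (hY : Measurable Y)
    (hY01 : ∀ᵐ ω ∂P, Y ω = 0 ∨ Y ω = 1) (hpos : ∀ s : Fin 2, 0 < P (S ⁻¹' {s}))
    (h0 : jordanMass P X S ≠ 0) (hgraph : GraphAssumption P X S Y) {κ : ℝ → ℝ}
    (hκ : ∀ y, κ y ∈ fairShifts P X S Y y)
    (hnest : ∀ᵐ x ∂(featureLaw P X), Antitone fun y => shiftedClassifier P X S Y y (κ y) x) :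
    IsNestedFamily (featureLaw P X) (bayesRegression P X Y) (Delta P X S) κ where
  measurable_eta := measurable_bayesRegression
  measurable_delta := measurable_Delta
  eta_mem := bayesRegression_mem hX hY hY01
  integrable_delta := integrable_Delta h0
  integral_delta := by
    have := isProbabilityMeasure_groupLaw hX (hpos 0)
    have := isProbabilityMeasure_groupLaw hX (hpos 1)
    rw [← setIntegral_univ, setIntegral_Delta_eq_zero_iff hX h0 MeasurableSet.univ]
    simp
  fair y := by
    have h : muPlus P X S (accept (bayesRegression P X Y) (Delta P X S) κ y) =
      muMinus P X S (accept (bayesRegression P X Y) (Delta P X S) κ y) := hκ y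
    rw [setIntegral_Delta hX h0, measureReal_def, measureReal_def, h, sub_self]
  nested := by
    filter_upwards [hnest] with x hx y z hyz hz
    have h := hx hyz
    by_contra hy
    have h1 : shiftedClassifier P X S Y z (κ z) x = 1 := indicator_of_mem (by exact hz) _
    have h2 : shiftedClassifier P X S Y y (κ y) x = 0 := indicator_of_notMem (by exact hy) _
    simp only [h1, h2] at h
    linarith
  null_graph := measure_graph_eq_zero hX h0 hgraph

/-- Truncation to the unit interval. -/
def clip (t : ℝ) : ℝ := max 0 (min 1 t)

lemma measurable_clip : Measurable clip :=
  measurable_const.max (measurable_const.min measurable_id)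

lemma clip_mem (t : ℝ) : clip t ∈ Icc (0 : ℝ) 1 :=
  ⟨le_max_left _ _, max_le zero_le_one (min_le_left _ _)⟩

/-- Projecting onto an interval containing `a` strictly decreases the distance to `a` unless `t` is
already in it. The equality case is what makes minimizers `[0, 1]`-valued a.e. -/
lemma sq_sub_clip {a t : ℝ} (ha : a = 0 ∨ a = 1) :
    (a - clip t) ^ 2 ≤ (a - t) ^ 2 ∧ ((a - clip t) ^ 2 = (a - t) ^ 2 → clip t = t) := by
  unfold clip
  rcases le_or_gt t 0 with h | h
  · rw [max_eq_left ((min_le_right _ _).trans h)]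
    refine ⟨?_, fun he => ?_⟩ <;> rcases ha with rfl | rfl <;> nlinarith
  rcases le_or_gt t 1 with h1 | h1
  · rw [min_eq_right h1, max_eq_right h.le]
    exact ⟨le_rfl, fun _ => rfl⟩
  · rw [min_eq_left h1.le, max_eq_right zero_le_one]
    refine ⟨?_, fun he => ?_⟩ <;> rcases ha with rfl | rfl <;> nlinarith

lemma quadraticRisk_clip_le (hY01 : ∀ᵐ ω ∂P, Y ω = 0 ∨ Y ω = 1) (f : 𝒳 → ℝ) :
    quadraticRisk P X Y (fun x => clip (f x)) ≤ quadraticRisk P X Y f := by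
  refine lintegral_mono_ae ?_
  filter_upwards [hY01] with ω hω
  exact ENNReal.ofReal_le_ofReal (sq_sub_clip hω).1

lemma clip_ae_eq (hX : Measurable X) (hY : Measurable Y)
    (hY01 : ∀ᵐ ω ∂P, Y ω = 0 ∨ Y ω = 1) {f : 𝒳 → ℝ} (hf : Measurable f)
    (hle : quadraticRisk P X Y f ≤ quadraticRisk P X Y fun x => clip (f x)) :
    (fun x => clip (f x)) =ᵐ[featureLaw P X] f := by
  have hcm : Measurable fun x => clip (f x) := measurable_clip.comp hf
  have hfin : quadraticRisk P X Y (fun x => clip (f x)) ≠ ⊤ := by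
    rw [quadraticRisk_eq hX hY hY01 hcm fun x => clip_mem _]
    exact ENNReal.ofReal_ne_top
  have hae := ae_eq_of_ae_le_of_lintegral_le (μ := P)
    (f := fun ω => ENNReal.ofReal ((Y ω - clip (f (X ω))) ^ 2))
    (g := fun ω => ENNReal.ofReal ((Y ω - f (X ω)) ^ 2))
    (by filter_upwards [hY01] with ω hω using ENNReal.ofReal_le_ofReal (sq_sub_clip hω).1)
    hfin ((hY.sub (hf.comp hX)).pow_const 2).ennreal_ofReal.aemeasurable hle
  change ∀ᵐ x ∂(P.map X), clip (f x) = f x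
  rw [ae_map_iff hX.aemeasurable (measurableSet_eq_fun hcm hf)]
  filter_upwards [hY01, hae] with ω hω h
  exact (sq_sub_clip hω).2
    ((ENNReal.ofReal_eq_ofReal_iff (sq_nonneg _) (sq_nonneg _)).1 h)

end Main

end FairLearning

end

open FairLearning Set in
theorem mainTheorem3 {Ω : Type*} {𝒳 : Type*} [MeasurableSpace Ω] [MeasurableSpace 𝒳]
    (P : Measure Ω) [IsProbabilityMeasure P]
    (X : Ω → 𝒳) (S : Ω → Fin 2) (Y : Ω → ℝ)
    (hX : Measurable X) (hS : Measurable S) (hY : Measurable Y)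
    (hY01 : ∀ᵐ ω ∂P, Y ω = 0 ∨ Y ω = 1)
    (hpos : ∀ s : Fin 2, 0 < P (S ⁻¹' {s}))
    (hne : FairLearning.groupLaw P X S 0 ≠ FairLearning.groupLaw P X S 1)
    (hgraph : FairLearning.GraphAssumption P X S Y)
    (hnested : FairLearning.Nested P X S Y) :
    ∃ fstar : 𝒳 → ℝ,
      FairLearning.IsOptimalFairRegression P X S Y fstar ∧
      (∀ f : 𝒳 → ℝ, FairLearning.IsOptimalFairRegression P X S Y f →
        f =ᵐ[FairLearning.featureLaw P X] fstar) ∧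
      ∀ f : 𝒳 → ℝ, FairLearning.IsOptimalFairRegression P X S Y f →
        ∀ y : ℝ, FairLearning.IsOptimalFairClassifier P X S Y y
          (FairLearning.threshold f y) := by
  have h0 := jordanMass_ne_zero hX hpos hne
  have := isProbabilityMeasure_featureLaw (P := P) hX
  obtain ⟨κ, hκ, hnest⟩ := hnested
  have hfam := isNestedFamily hX hY hY01 hpos h0 hgraph hκ hnest
  have hdp : ∀ {f : 𝒳 → ℝ}, Measurable f →
      (DemographicParity P X S f ↔ LevelFair (featureLaw P X) (Delta P X S) f) :=
    fun hf => demographicParity_iff_levelFair hX hS hpos h0 hf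
  let fs := nestedSup (bayesRegression P X Y) (Delta P X S) κ
  have hfsm : Measurable fs := hfam.measurable_nestedSup
  have hfsdp : DemographicParity P X S fs := (hdp hfsm).2 hfam.levelFair_nestedSup
  have hopt : IsOptimalFairRegression P X S Y fs := by
    refine ⟨⟨hfsm, hfsdp⟩, fun f hf hfdp => ?_⟩
    -- Truncation is a function of `f(X)`, so it keeps parity and the competitor may be taken in
    -- `[0, 1]`.
    refine le_trans ?_ (quadraticRisk_clip_le hY01 f)
    have hcm : Measurable fun x => clip (f x) := measurable_clip.comp hf
    rw [quadraticRisk_eq hX hY hY01 hfsm nestedSup_mem,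
      quadraticRisk_eq hX hY hY01 hcm fun x => clip_mem _]
    refine ENNReal.ofReal_le_ofReal ?_
    rw [integral_response_sub_sq hX hY hY01 hfsm nestedSup_mem,
      integral_response_sub_sq hX hY hY01 hcm fun x => clip_mem _]
    have := hfam.integral_nestedSup_le hcm (fun x => clip_mem _)
      ((hdp hcm).1 (hfdp.comp measurable_clip))
    linarith
  have huniq : ∀ f : 𝒳 → ℝ, IsOptimalFairRegression P X S Y f → f =ᵐ[featureLaw P X] fs := by
    rintro f ⟨⟨hf, hfdp⟩, hmin⟩
    have hcm : Measurable fun x => clip (f x) := measurable_clip.comp hf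
    have hcdp : DemographicParity P X S fun x => clip (f x) := hfdp.comp measurable_clip
    refine (clip_ae_eq hX hY hY01 hf (hmin _ hcm hcdp)).symm.trans ?_
    refine hfam.ae_eq_nestedSup hcm (fun x => clip_mem _) ((hdp hcm).1 hcdp) ?_
    have hle := (quadraticRisk_clip_le (X := X) hY01 f).trans (hmin fs hfsm hfsdp)
    rw [quadraticRisk_eq hX hY hY01 hfsm nestedSup_mem,
      quadraticRisk_eq hX hY hY01 hcm fun x => clip_mem _,
      ENNReal.ofReal_le_ofReal_iff (integral_nonneg fun ω => sq_nonneg _),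
      integral_response_sub_sq hX hY hY01 hfsm nestedSup_mem,
      integral_response_sub_sq hX hY hY01 hcm fun x => clip_mem _] at hle
    linarith
  refine ⟨fs, hopt, huniq, fun f hfopt y => ?_⟩
  have hf := hfopt.1.1
  have hlev : MeasurableSet {x | y ≤ f x} := measurableSet_le measurable_const hf
  have hcl : IsClassifier (threshold f y) := by
    refine ⟨measurable_one.indicator hlev, fun x => ?_⟩
    by_cases hx : x ∈ {x | y ≤ f x}
    · exact Or.inr (indicator_of_mem hx _)
    · exact Or.inl (indicator_of_notMem hx _)
  -- By uniqueness, thresholding any solution selects, up to a null set, the level set of `fs`,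
  -- whose optimality is known at this exact `y`.
  have hset : ({x | 1 ≤ threshold f y x} : Set 𝒳) =ᵐ[featureLaw P X] {x | y ≤ fs x} := by
    refine Filter.eventuallyEq_set.2 ?_
    filter_upwards [huniq f hfopt] with x hx
    change 1 ≤ indicator {x | y ≤ f x} 1 x ↔ y ≤ fs x
    rw [← hx]
    by_cases h : y ≤ f x <;> simp [h]
  refine ⟨⟨hcl, ?_⟩, fun g hg hgdp => ?_⟩
  · exact hfopt.1.2.comp (φ := (Ici y).indicator 1) (measurable_one.indicator measurableSet_Ici)
  · rw [costRisk_eq hX hY hY01 hcl, costRisk_eq hX hY hY01 hg, setIntegral_congr_set hset]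
    -- The competing balanced set is `{g = 1}`, written as the level set of `g` at height `1`.
    have := hfam.setIntegral_nestedSup_le y (measurableSet_le measurable_const hg.1)
      ((hdp hg.1).1 hgdp 1)
    linarith
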